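/- **Model.** A state $\theta\in\{\mathfrak g,\mathfrak b\}$ is drawn uniformly, and, independently of $\theta$, $\omega\in\{0,1\}$ is drawn with $\mathbb P[\omega=1]=\gamma\in(0,1)$. Conditional on $(\omega,\theta)$, signals $s_1,s_2,\dots$ with values in a measurable space $S$ are i.i.d., with law $\mu_\theta$ if $\omega=1$ and law $\mu_0$ (not depending on $\theta$) if $\omega=0$. Agent $t=1,2,\dots$ observes the history $H_t=(a_1,\dots,a_{t-1})$ of earlier actions and her signal $s_t$ and chooses an action $a_t\in\{\mathfrak g,\mathfrak b\}$, with payoff $1$ if $a_t=\theta$ and $0$ otherwise. Actions follow a Bayesian Nash equilibrium in pure (measurable) strategies: almost surely, $a_t$ maximizes the expected payoff conditional on $(H_t,s_t)$. **Assumptions on signals.** The probability measures $\mu_{\mathfrak g},\mu_{\mathfrak b},\mu_0$ are pairwise distinct and mutually absolutely continuous. Let $\ell=\log\frac{d\mu_{\mathfrak g}}{d\mu_{\mathfrak b}}(s)$ be the private log-likelihood ratio and let $F_{\mathfrak g},F_{\mathfrak b},F_0$ be the CDFs of $\ell$ when $s$ has law $\mu_{\mathfrak g},\mu_{\mathfrak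 b},\mu_0$. Assume that signals are unbounded (for every $M\in\mathbb R$, both $\ell>M$ and $\ell<-M$ have positive probability); that $F_{\mathfrak g}(x)+F_{\mathfrak b}(-x)=1$ for all $x\in\mathbb R$; that $F_{\mathfrak g},F_{\mathfrak b},F_0$ are continuous; and that for all sufficiently large $x$, $F_{\mathfrak b}$ is differentiable at $-x$ with derivative less than $1$. **Tails.** For $\theta\in\{\mathfrak g,\mathfrak b\}$ let $L_\theta(x)=\frac{F_0(-x)}{F_\theta(-x)}$ and $R_\theta(x)=\frac{1-F_0(x)}{1-F_\theta(x)}$. The uninformative signals have *fatter tails* than the informative signals if there is $\varepsilon>0$ such that $L_{\mathfrak b}(x)\ge\varepsilon$ and $R_{\mathfrak g}(x)\ge\varepsilon$ for all $x$ large enough. They have *thinner tails* if there is $\varepsilon>0$ such that either $L_{\mathfrak g}(x)\le 1/\varepsilon$ for all $x$ large enough, or $R_{\mathfrak b}(x)\le1/\varepsilon$ for all $x$ large enough. **Learning.** Let $q_t=\mathbb P[\omega=1\mid H_t]$. *Asymptotic learning of informativeness* holds if, for each $w\in\{0,1\}$, $\lim_{t\to\infty}q_t=w$ almost surely with respect to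 $\mathbb P[\,\cdot\mid\omega=w]$. **Theorem.** If the uninformative signals have fatter tails than the informative signals, then asymptotic learning of informativeness holds. If they have thinner tails, then asymptotic learning of informativeness fails. -/

import Mathlib

open MeasureTheory ProbabilityTheory Filter Topology

noncomputable section

namespace SocialLearning

/-- The payoff-relevant state `θ`; actions take values in the same set. -/
abbrev State : Type := Bool

/-- The good state `𝔤`. -/
abbrev good : State := true

/-- The bad state `𝔟`. -/
abbrev bad : State := false

section InformationStructure

variable {S : Type*} [MeasurableSpace S]

/-- Private log-likelihood ratio `ℓ(s) = log (dμ_𝔤/dμ_𝔟)(s)`. -/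
def privateLLR (μ : State → Measure S) : S → ℝ :=
  llr (μ good) (μ bad)

/-- CDF of the private LLR when signals are drawn from `ν`: it is `F_θ` for `ν = μ θ`
and `F_0` for `ν = μ₀`. -/
def llrCDF (μ : State → Measure S) (ν : Measure S) (x : ℝ) : ℝ :=
  cdf (ν.map (privateLLR μ)) x

/-- Left tail ratio `L_θ(x) = F_0(-x) / F_θ(-x)`. -/
def leftRatio (μ : State → Measure S) (μ₀ : Measure S) (v : State) (x : ℝ) : ℝ :=
  llrCDF μ μ₀ (-x) / llrCDF μ (μ v) (-x)

/-- Right tail ratio `R_θ(x) = (1 - F_0(x)) / (1 - F_θ(x))`. -/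
def rightRatio (μ : State → Measure S) (μ₀ : Measure S) (v : State) (x : ℝ) : ℝ :=
  (1 - llrCDF μ μ₀ x) / (1 - llrCDF μ (μ v) x)

/-- The uninformative signals have fatter tails than the informative signals. -/
def FatterTails (μ : State → Measure S) (μ₀ : Measure S) : Prop :=
  ∃ ε : ℝ, 0 < ε ∧
    (∀ᶠ x in atTop, ε ≤ leftRatio μ μ₀ bad x) ∧
    (∀ᶠ x in atTop, ε ≤ rightRatio μ μ₀ good x)

/-- The uninformative signals have thinner tails than the informative signals. -/
def ThinnerTails (μ : State → Measure S) (μ₀ : Measure S) : Prop :=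
  ∃ ε : ℝ, 0 < ε ∧
    ((∀ᶠ x in atTop, leftRatio μ μ₀ good x ≤ 1 / ε) ∨
      (∀ᶠ x in atTop, rightRatio μ μ₀ bad x ≤ 1 / ε))

/-- Standing assumptions on the signal distributions `μ_𝔤 = μ good`, `μ_𝔟 = μ bad`, `μ₀`. -/
structure IsInformationStructure (μ : State → Measure S) (μ₀ : Measure S) : Prop where
  isProbabilityMeasure : ∀ v, IsProbabilityMeasure (μ v)
  isProbabilityMeasure₀ : IsProbabilityMeasure μ₀
  /-- The three distributions are distinct. -/
  good_ne_bad : μ good ≠ μ bad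
  ne_uninformative : ∀ v, μ v ≠ μ₀
  /-- The three distributions are mutually absolutely continuous. -/
  informative_ac : ∀ v v', μ v ≪ μ v'
  informative_ac_uninformative : ∀ v, μ v ≪ μ₀
  uninformative_ac_informative : ∀ v, μ₀ ≪ μ v
  /-- Unbounded signals. By mutual absolute continuity it does not matter under which of the
  three distributions the probabilities are taken. -/
  unbounded_above : ∀ M : ℝ, 0 < μ good {s | M < privateLLR μ s}
  unbounded_below : ∀ M : ℝ, 0 < μ good {s | privateLLR μ s < -M}
  /-- `(F_𝔤, F_𝔟)` is symmetric around zero. -/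
  symmetric : ∀ x : ℝ, llrCDF μ (μ good) x + llrCDF μ (μ bad) (-x) = 1
  /-- The three CDFs are continuous. -/
  continuous_informative : ∀ v, Continuous (llrCDF μ (μ v))
  continuous_uninformative : Continuous (llrCDF μ μ₀)
  /-- `F_𝔟` is differentiable on a left tail, with density less than one there. -/
  left_tail : ∀ᶠ x : ℝ in atTop,
    DifferentiableAt ℝ (llrCDF μ (μ bad)) (-x) ∧ deriv (llrCDF μ (μ bad)) (-x) < 1

/-- Distribution of one signal given informativeness `w` and state `v`. -/
def signalLaw (μ : State → Measure S) (μ₀ : Measure S) (w : Fin 2) (v : State) : Measure S :=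
  if w = 1 then μ v else μ₀

end InformationStructure

section Model

variable {Ω S : Type*} [MeasurableSpace Ω] [MeasurableSpace S]

/-- `θ` (the state), `ω` (the informativeness of the source) and `s` (the private signals, agents
being indexed from `0`) are random variables on `(Ω, P)` with the joint law of the model:
`θ` is uniform, `ω` is independent of `θ` with `P(ω = 1) = γ`, and conditionally on `(ω, θ)`
the signals are i.i.d. with law `μ_θ` if `ω = 1` and `μ₀` if `ω = 0`. -/
structure IsSignalProcess (P : Measure Ω) (γ : ℝ) (μ : State → Measure S) (μ₀ : Measure S)
    (θ : Ω → State) (ω : Ω → Fin 2) (s : ℕ → Ω → S) : Prop where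
  measurable_state : Measurable θ
  measurable_source : Measurable ω
  measurable_signal : ∀ t, Measurable (s t)
  prob_state : ∀ v, P.real (θ ⁻¹' {v}) = 1 / 2
  prob_source : P.real (ω ⁻¹' {1}) = γ
  indep_state_source : IndepFun θ ω P
  indep_signal : ∀ w v, iIndepFun s P[|ω ⁻¹' {w} ∩ θ ⁻¹' {v}]
  law_signal : ∀ w v t, (P[|ω ⁻¹' {w} ∩ θ ⁻¹' {v}]).map (s t) = signalLaw μ μ₀ w v

/-- A pure strategy of agent `t`, who observes `t` earlier actions and her own signal. -/
abbrev Strategy (S : Type*) (t : ℕ) : Type _ := (Fin t → State) × S → State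

/-- `history σ s t x` lists the actions of agents `0, …, t - 1` at the outcome `x` under the
strategy profile `σ`. -/
def history (σ : ∀ t, Strategy S t) (s : ℕ → Ω → S) : ∀ t : ℕ, Ω → Fin t → State
  | 0, _ => Fin.elim0
  | t + 1, x => Fin.snoc (α := fun _ => State) (history σ s t x) (σ t (history σ s t x, s t x))

/-- What agent `t` observes: the history of actions and her private signal. -/
def information (σ : ∀ t, Strategy S t) (s : ℕ → Ω → S) (t : ℕ) (x : Ω) : (Fin t → State) × S :=
  (history σ s t x, s t x)

/-- Payoff of agent `t` when her predecessors follow `σ` and she uses the strategy `τ`: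
one if her action matches the state and zero otherwise. -/
def payoff (θ : Ω → State) (σ : ∀ t, Strategy S t) (s : ℕ → Ω → S) (t : ℕ) (τ : Strategy S t)
    (x : Ω) : ℝ :=
  if τ (information σ s t x) = θ x then 1 else 0

/-- Bayesian Nash equilibrium in pure strategies: no agent has a deviation with a strictly higher
expected payoff conditional on her information. -/
structure IsEquilibrium (P : Measure Ω) (θ : Ω → State) (s : ℕ → Ω → S)
    (σ : ∀ t, Strategy S t) : Prop where
  measurable : ∀ t, Measurable (σ t)
  optimal : ∀ (t : ℕ) (τ : Strategy S t), Measurable τ →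
    P[payoff θ σ s t τ | MeasurableSpace.comap (information σ s t) inferInstance]
      ≤ᵐ[P] P[payoff θ σ s t (σ t) | MeasurableSpace.comap (information σ s t) inferInstance]

/-- The outside observer's belief `P[ω = 1 | H_t]`, where `H_t` consists of the first `t`
actions. -/
def belief (P : Measure Ω) (ω : Ω → Fin 2) (s : ℕ → Ω → S) (σ : ∀ t, Strategy S t) (t : ℕ) :
    Ω → ℝ :=
  P[(ω ⁻¹' {1}).indicator (fun _ => (1 : ℝ)) |
    MeasurableSpace.comap (history σ s t) inferInstance]

/-- Asymptotic learning of informativeness: for each `w ∈ {0, 1}`, the observer's belief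
converges to `w` almost surely conditional on `ω = w`. -/
def AsymptoticLearning (P : Measure Ω) (ω : Ω → Fin 2) (s : ℕ → Ω → S)
    (σ : ∀ t, Strategy S t) : Prop :=
  ∀ w : Fin 2, ∀ᵐ x ∂P[|ω ⁻¹' {w}],
    Tendsto (fun t => belief P ω s σ t x) atTop (𝓝 ((w : ℕ) : ℝ))

end Model

end SocialLearning

end

/-! When `ω = 0` signals carry no news about `θ`, so no action affects the comparison between the
two states. Agents therefore behave as if signals were informative: `IsEquilibrium.obedient`
replaces equilibrium by `Obedient`, a condition on the i.i.d. laws with marginals `μ good` and `μ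
bad` alone.

Under informative signals agents eventually all choose correctly. Imitating the predecessor never
loses, and overruling it after extreme signals gains a definite amount as long as errors persist;
unboundedness supplies such signals, so error probabilities vanish. Obedience at the first switch
away from the right action then bounds the probability of any later error
(`Obedient.measure_exists_error_le`).

Along a fixed sequence of actions agents use a cutoff in the private log-likelihood ratio, at a
public ratio that does not depend on the true law. A herd on `v` thus has probability an infinite
product of terms one minus a tail, positive exactly when all factors are positive and the tails are
summable. Comparing tails transfers positive probability of a herd from one law to another
(`Obedient.measure_pathEvent_ne_zero`).

With fatter tails, a herd possible under `μ₀` would also be possible when signals are informative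
and the herd is wrong, which is excluded. Hence herding occurs almost surely if `ω = 1` and almost
never if `ω = 0`, and Lévy's zero-one law gives learning. With thinner tails, a correct herd is also
possible under `μ₀`. The belief along it depends on the actions only, so it cannot converge to both
`1` and `0`. -/

noncomputable section

namespace SocialLearning

/-! ### Change of measure through the log-likelihood ratio. -/

section LogLikelihood

variable {S : Type*} [MeasurableSpace S] {α β : Measure S}
  [IsProbabilityMeasure α] [IsProbabilityMeasure β]

lemma real_eq_setIntegral_exp_llr (hαβ : α ≪ β) (hβα : β ≪ α) {D : Set S} :
    α.real D = ∫ x in D, Real.exp (llr α β x) ∂β := by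
  rw [← Measure.setIntegral_toReal_rnDeriv hαβ D]
  exact integral_congr_ae (ae_restrict_of_ae ((exp_llr_of_ac' α β hβα).symm))

lemma integrable_exp_llr (hβα : β ≪ α) : Integrable (fun x => Real.exp (llr α β x)) β :=
  Measure.integrable_toReal_rnDeriv.congr (exp_llr_of_ac' α β hβα).symm

lemma real_le_exp_mul_of_llr_le (hαβ : α ≪ β) (hβα : β ≪ α) {D : Set S}
    (hD : MeasurableSet D) {c : ℝ} (h : ∀ x ∈ D, llr α β x ≤ c) :
    α.real D ≤ Real.exp c * β.real D := by
  rw [real_eq_setIntegral_exp_llr hαβ hβα]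
  calc ∫ x in D, Real.exp (llr α β x) ∂β ≤ ∫ _ in D, Real.exp c ∂β :=
        setIntegral_mono_on (integrable_exp_llr hβα).integrableOn (by simp) hD
          fun x hx => Real.exp_le_exp.2 (h x hx)
    _ = Real.exp c * β.real D := by simp [mul_comm]

/-- A set on which the likelihood ratio exceeds `exp c` pointwise, but not on average, is null. -/
lemma measure_eq_zero_of_lt_llr (hαβ : α ≪ β) (hβα : β ≪ α) {D : Set S}
    (hD : MeasurableSet D) {c : ℝ} (h : ∀ x ∈ D, c < llr α β x)
    (hle : α.real D ≤ Real.exp c * β.real D) : β D = 0 := by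
  have hint : Integrable (fun x => Real.exp (llr α β x) - Real.exp c) (β.restrict D) :=
    (integrable_exp_llr hβα).integrableOn.sub (integrable_const _)
  have hnn : 0 ≤ᵐ[β.restrict D] fun x => Real.exp (llr α β x) - Real.exp c := by
    filter_upwards [ae_restrict_mem hD] with x hx
    exact sub_nonneg.2 (Real.exp_le_exp.2 (h x hx).le)
  have hzero : ∫ x in D, (Real.exp (llr α β x) - Real.exp c) ∂β = 0 := by
    refine le_antisymm ?_ (integral_nonneg_of_ae hnn)
    rw [integral_sub (integrable_exp_llr hβα).integrableOn (integrable_const _),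
      ← real_eq_setIntegral_exp_llr hαβ hβα]
    simp only [integral_const, measureReal_restrict_apply_univ, smul_eq_mul]
    linarith
  have hae := (integral_eq_zero_iff_of_nonneg_ae hnn hint).1 hzero
  have hfalse : ∀ᵐ x ∂(β.restrict D), False := by
    filter_upwards [hae, ae_restrict_mem hD] with x hx hxD
    have := Real.exp_lt_exp.2 (h x hxD)
    simp only [Pi.zero_apply] at hx
    linarith
  rw [← Measure.restrict_eq_zero, ← ae_eq_bot]
  exact Filter.eventually_false_iff_eq_bot.1 hfalse

end LogLikelihood

/-! ### Infinite products and summability of their defects. -/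

section InfiniteProduct

/-- The inequality `a ≤ exp (-(1 - a))` bounds every partial sum of defects by `-log c`. -/
lemma summable_one_sub_of_le_prod {a : ℕ → ℝ} (h1 : ∀ i, a i ≤ 1) (h0 : ∀ i, 0 ≤ a i)
    {c : ℝ} (hc : 0 < c) (h : ∀ t, c ≤ ∏ i ∈ Finset.range t, a i) :
    Summable fun i => 1 - a i := by
  refine summable_of_sum_range_le (c := -Real.log c) (fun i => sub_nonneg.2 (h1 i)) fun t => ?_
  have h2 : ∏ i ∈ Finset.range t, a i ≤ Real.exp (-∑ i ∈ Finset.range t, (1 - a i)) := by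
    rw [← Finset.sum_neg_distrib, Real.exp_sum]
    refine Finset.prod_le_prod (fun i _ => h0 i) fun i _ => ?_
    have := Real.add_one_le_exp (-(1 - a i))
    linarith
  have h3 := (Real.log_le_iff_le_exp hc).2 ((h t).trans h2)
  linarith

lemma exists_pos_le_prod_of_summable {a : ℕ → ℝ} (h1 : ∀ i, a i ≤ 1) (h0 : ∀ i, 0 < a i)
    (h : Summable fun i => 1 - a i) :
    ∃ c > 0, ∀ t, c ≤ ∏ i ∈ Finset.range t, a i := by
  have hs : Summable fun i => Real.log (a i) := by
    simpa using Real.summable_log_one_add_of_summable h.neg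
  refine ⟨Real.exp (∑' i, Real.log (a i)), Real.exp_pos _, fun t => ?_⟩
  calc Real.exp (∑' i, Real.log (a i)) ≤ Real.exp (∑ i ∈ Finset.range t, Real.log (a i)) := by
        have := hs.neg.sum_le_tsum (Finset.range t)
          (fun i _ => neg_nonneg.2 (Real.log_nonpos (h0 i).le (h1 i)))
        rw [tsum_neg, Finset.sum_neg_distrib] at this
        exact Real.exp_le_exp.2 (neg_le_neg_iff.1 this)
    _ = ∏ i ∈ Finset.range t, a i := by
        rw [Real.exp_sum]
        exact Finset.prod_congr rfl fun i _ => Real.exp_log (h0 i)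

end InfiniteProduct

/-! ### Histories, fixed action paths and herds. -/

section Paths

variable {Ω S : Type*}

/-- The action of agent `t` under the strategy profile `σ`. -/
def action (σ : ∀ t, Strategy S t) (s : ℕ → Ω → S) (t : ℕ) (x : Ω) : State :=
  σ t (information σ s t x)

/-- The first `t` entries of a sequence of actions. -/
def prefixOf (y : ℕ → State) (t : ℕ) : Fin t → State := fun j => y j

/-- The signal process on the space of signal sequences. -/
abbrev coord (t : ℕ) (z : ℕ → S) : S := z t

/-- The signals that make agent `t` continue the sequence of actions `y`. -/
def continuing (σ : ∀ t, Strategy S t) (y : ℕ → State) (t : ℕ) : Set S :=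
  {a | σ t (prefixOf y t, a) = y t}

lemma history_apply (σ : ∀ t, Strategy S t) (s : ℕ → Ω → S) (t : ℕ) (x : Ω) (i : Fin t) :
    history σ s t x i = action σ s i x := by
  induction t with
  | zero => exact i.elim0
  | succ t ih =>
    refine Fin.lastCases ?_ (fun j => ?_) i
    · simp [history, action, information]
    · simp [history, ih]

/-- Play is a function of the signal sequence, so events about actions can be studied on `ℕ → S`
under product laws and pulled back to `Ω`. -/
lemma history_eq_coord (σ : ∀ t, Strategy S t) (s : ℕ → Ω → S) (t : ℕ) (x : Ω) :
    history σ s t x = history σ coord t (fun i => s i x) := by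
  induction t with
  | zero => rfl
  | succ t ih => simp [history, ih]

lemma information_eq_coord (σ : ∀ t, Strategy S t) (s : ℕ → Ω → S) (t : ℕ) (x : Ω) :
    information σ s t x = information σ coord t (fun i => s i x) := by
  simp [information, ← history_eq_coord]

lemma action_eq_coord (σ : ∀ t, Strategy S t) (s : ℕ → Ω → S) (t : ℕ) (x : Ω) :
    action σ s t x = action σ coord t (fun i => s i x) := by
  simp [action, ← information_eq_coord]

/-- Once the history is pinned to `y`, each action constrains only the agent's own signal. The event
becomes a rectangle, whose product probability is explicit. -/
lemma history_eq_prefixOf_iff (σ : ∀ t, Strategy S t) (y : ℕ → State) (t : ℕ) (z : ℕ → S) :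
    history σ coord t z = prefixOf y t ↔ ∀ i < t, z i ∈ continuing σ y i := by
  induction t with
  | zero => simp only [Nat.not_lt_zero, false_implies, implies_true, iff_true]
            exact funext fun i => i.elim0
  | succ t ih =>
    have hsplit : history σ coord (t + 1) z = prefixOf y (t + 1) ↔
        history σ coord t z = prefixOf y t ∧ action σ coord t z = y t := by
      simp only [funext_iff, history_apply, prefixOf]
      constructor
      · intro h
        exact ⟨fun i => h i.castSucc, by simpa using h (Fin.last t)⟩
      · rintro ⟨h1, h2⟩ i
        refine Fin.lastCases (by simpa using h2) (fun j => ?_) i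
        simpa using h1 j
    rw [hsplit]
    constructor
    · rintro ⟨h1, h2⟩ i hi
      rcases Nat.lt_succ_iff_lt_or_eq.1 hi with h | rfl
      · exact ih.1 h1 i h
      · rw [action, information, h1] at h2
        exact h2
    · intro h
      have h1 := ih.2 fun i hi => h i (hi.trans (Nat.lt_succ_self t))
      refine ⟨h1, ?_⟩
      rw [action, information, h1]
      exact h t (Nat.lt_succ_self t)

/-- The sequence of actions that starts with `h` and is constantly `v` afterwards. -/
def extend {T : ℕ} (h : Fin T → State) (v : State) (i : ℕ) : State :=
  if hi : i < T then h ⟨i, hi⟩ else v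

lemma prefixOf_extend {T : ℕ} (h : Fin T → State) (v : State) : prefixOf (extend h v) T = h := by
  ext i
  simp [prefixOf, extend]

lemma extend_of_le {T : ℕ} (h : Fin T → State) (v : State) {i : ℕ} (hi : T ≤ i) :
    extend h v i = v := by
  simp [extend, hi]

/-- The event that every agent acts as in `y`. -/
def pathEvent (σ : ∀ t, Strategy S t) (s : ℕ → Ω → S) (y : ℕ → State) : Set Ω :=
  {x | ∀ t, action σ s t x = y t}

lemma history_eq_of_mem_pathEvent {σ : ∀ t, Strategy S t} {s : ℕ → Ω → S} {y : ℕ → State} {x : Ω}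
    (hx : x ∈ pathEvent σ s y) (t : ℕ) : history σ s t x = prefixOf y t :=
  funext fun i => (history_apply σ s t x i).trans (hx i)

/-- The event that all but finitely many agents choose `v`. -/
def eventuallyActs (σ : ∀ t, Strategy S t) (s : ℕ → Ω → S) (v : State) : Set Ω :=
  {x | ∃ T, ∀ t ≥ T, action σ s t x = v}

/-- There are only countably many finite prefixes, so a herd is null if and only if each single path
ending in it is null. -/
lemma eventuallyActs_eq_iUnion (σ : ∀ t, Strategy S t) (s : ℕ → Ω → S) (v : State) :
    eventuallyActs σ s v
      = ⋃ (T : ℕ) (h : Fin T → State), pathEvent σ s (extend h v) := by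
  ext x
  simp only [eventuallyActs, pathEvent, Set.mem_ofPred_eq, Set.mem_iUnion]
  constructor
  · rintro ⟨T, hT⟩
    refine ⟨T, history σ s T x, fun t => ?_⟩
    by_cases ht : t < T
    · simp [extend, ht, history_apply]
    · rw [hT t (not_lt.1 ht), extend_of_le _ _ (not_lt.1 ht)]
  · rintro ⟨T, h, hx⟩
    exact ⟨T, fun t ht => (hx t).trans (extend_of_le h v ht)⟩

lemma preimage_pathEvent (σ : ∀ t, Strategy S t) (s : ℕ → Ω → S) (y : ℕ → State) :
    (fun x i => s i x) ⁻¹' pathEvent σ coord y = pathEvent σ s y := by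
  ext x
  simp only [pathEvent, Set.mem_preimage, Set.mem_ofPred_eq, action_eq_coord σ s]

lemma preimage_eventuallyActs (σ : ∀ t, Strategy S t) (s : ℕ → Ω → S) (v : State) :
    (fun x i => s i x) ⁻¹' eventuallyActs σ coord v = eventuallyActs σ s v := by
  ext x
  simp only [eventuallyActs, Set.mem_preimage, Set.mem_ofPred_eq, action_eq_coord σ s]

end Paths

/-! ### Play under i.i.d. signals. -/

section Canonical

variable {Ω S : Type*} [MeasurableSpace Ω] [MeasurableSpace S]

/-- Law of an i.i.d. sequence of signals. -/
abbrev iidLaw (ν : Measure S) : Measure (ℕ → S) := Measure.infinitePi fun _ : ℕ => ν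

/-- Probability that the first `t` actions are those of `y` when signals are i.i.d. with law `ν`. -/
def prefixProb (σ : ∀ t, Strategy S t) (ν : Measure S) (y : ℕ → State) (t : ℕ) : ℝ :=
  ∏ i ∈ Finset.range t, ν.real (continuing σ y i)

lemma measurable_history {σ : ∀ t, Strategy S t} (hσ : ∀ t, Measurable (σ t)) {s : ℕ → Ω → S}
    (hs : ∀ t, Measurable (s t)) (t : ℕ) : Measurable (history σ s t) := by
  induction t with
  | zero => exact measurable_pi_iff.2 fun i => i.elim0
  | succ t ih =>
    refine measurable_pi_iff.2 fun i => ?_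
    refine Fin.lastCases ?_ (fun j => ?_) i
    · simpa [history, Function.comp_def] using (hσ t).comp (ih.prodMk (hs t))
    · simpa [history] using measurable_pi_iff.1 ih j

lemma measurable_information {σ : ∀ t, Strategy S t} (hσ : ∀ t, Measurable (σ t))
    {s : ℕ → Ω → S} (hs : ∀ t, Measurable (s t)) (t : ℕ) : Measurable (information σ s t) :=
  (measurable_history hσ hs t).prodMk (hs t)

lemma measurable_action {σ : ∀ t, Strategy S t} (hσ : ∀ t, Measurable (σ t)) {s : ℕ → Ω → S}
    (hs : ∀ t, Measurable (s t)) (t : ℕ) : Measurable (action σ s t) :=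
  (hσ t).comp (measurable_information hσ hs t)

lemma measurable_coord (t : ℕ) : Measurable (coord (S := S) t) := measurable_pi_apply t

lemma measurableSet_continuing {σ : ∀ t, Strategy S t} (hσ : ∀ t, Measurable (σ t))
    (y : ℕ → State) (t : ℕ) : MeasurableSet (continuing σ y t) :=
  ((hσ t).comp measurable_prodMk_left) (measurableSet_singleton (y t))

lemma iidLaw_real_prefix_inter {σ : ∀ t, Strategy S t} (hσ : ∀ t, Measurable (σ t))
    (ν : Measure S) [IsProbabilityMeasure ν] (y : ℕ → State) (t : ℕ) {A : Set S}
    (hA : MeasurableSet A) :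
    (iidLaw ν).real {z | history σ coord t z = prefixOf y t ∧ z t ∈ A}
      = prefixProb σ ν y t * ν.real A := by
  set B : ℕ → Set S := fun i => if i = t then A else continuing σ y i with hB
  have hset : {z : ℕ → S | history σ coord t z = prefixOf y t ∧ z t ∈ A}
      = Set.pi (Finset.range (t + 1)) B := by
    ext z
    simp only [history_eq_prefixOf_iff, Set.mem_ofPred_eq, Set.mem_pi, Finset.coe_range,
      Set.mem_Iio, hB]
    constructor
    · rintro ⟨h1, h2⟩ i hi
      split_ifs with h
      · exact h ▸ h2
      · exact h1 i (by omega)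
    · intro h
      refine ⟨fun i hi => ?_, by simpa using h t (by omega)⟩
      simpa [hi.ne] using h i (by omega)
  have hBm : ∀ i ∈ Finset.range (t + 1), MeasurableSet (B i) := by
    intro i _
    simp only [hB]
    split_ifs
    exacts [hA, measurableSet_continuing hσ y i]
  rw [hset, measureReal_def, Measure.infinitePi_pi _ hBm, ENNReal.toReal_prod,
    Finset.prod_range_succ, prefixProb]
  congr 1
  · refine Finset.prod_congr rfl fun i hi => ?_
    simp [hB, (Finset.mem_range.1 hi).ne, measureReal_def]
  · simp [hB, measureReal_def]

lemma iidLaw_real_prefix {σ : ∀ t, Strategy S t} (hσ : ∀ t, Measurable (σ t))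
    (ν : Measure S) [IsProbabilityMeasure ν] (y : ℕ → State) (t : ℕ) :
    (iidLaw ν).real {z | history σ coord t z = prefixOf y t} = prefixProb σ ν y t := by
  simpa using iidLaw_real_prefix_inter hσ ν y t MeasurableSet.univ

/-- The history and the current signal are independent. -/
lemma iidLaw_real_history_inter {σ : ∀ t, Strategy S t} (hσ : ∀ t, Measurable (σ t))
    (ν : Measure S) [IsProbabilityMeasure ν] (t : ℕ) (C : Set (Fin t → State)) {A : Set S}
    (hA : MeasurableSet A) :
    (iidLaw ν).real {z | history σ coord t z ∈ C ∧ z t ∈ A}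
      = (iidLaw ν).real {z | history σ coord t z ∈ C} * ν.real A := by
  classical
  have hm := measurable_history hσ (measurable_coord (S := S)) t
  have hfib : ∀ m : Measure (ℕ → S), IsFiniteMeasure m →
      m.real {z | history σ coord t z ∈ C}
        = ∑ h ∈ C.toFinset, m.real (history σ coord t ⁻¹' {h}) := by
    intro m _
    rw [sum_measureReal_preimage_singleton _ fun h _ => hm (measurableSet_singleton h)]
    simp [Set.preimage]
  have h1 := hfib ((iidLaw ν).restrict (coord t ⁻¹' A)) inferInstance
  rw [measureReal_restrict_apply (t := {z | history σ coord t z ∈ C})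
    (hm (Set.toFinite C).measurableSet)] at h1
  have h2 : ∀ h : Fin t → State,
      ((iidLaw ν).restrict (coord t ⁻¹' A)).real (history σ coord t ⁻¹' {h})
        = (iidLaw ν).real (history σ coord t ⁻¹' {h}) * ν.real A := by
    intro h
    rw [measureReal_restrict_apply (hm (measurableSet_singleton h))]
    -- The filler `true` is arbitrary, since only the first `t` entries of the extension matter.
    have e1 := iidLaw_real_prefix_inter hσ ν (extend h true) t hA
    rw [← iidLaw_real_prefix hσ, prefixOf_extend] at e1
    exact e1
  rw [hfib _ inferInstance, Finset.sum_mul]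
  simp only [h2] at h1
  exact h1

lemma measurableSet_pathEvent {σ : ∀ t, Strategy S t} (hσ : ∀ t, Measurable (σ t))
    {s : ℕ → Ω → S} (hs : ∀ t, Measurable (s t)) (y : ℕ → State) :
    MeasurableSet (pathEvent σ s y) := by
  rw [pathEvent, Set.ofPred_forall]
  exact MeasurableSet.iInter fun t => measurable_action hσ hs t (measurableSet_singleton (y t))

/-- The path event is the decreasing intersection of its prefix events, so its probability is the
limit of the partial products. -/
lemma pathEvent_pos_iff {σ : ∀ t, Strategy S t} (hσ : ∀ t, Measurable (σ t))
    (ν : Measure S) [IsProbabilityMeasure ν] (y : ℕ → State) :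
    iidLaw ν (pathEvent σ coord y) ≠ 0 ↔ ∃ c > 0, ∀ t, c ≤ prefixProb σ ν y t := by
  have hsub : ∀ t, pathEvent σ coord y ⊆ {z : ℕ → S | history σ coord t z = prefixOf y t} :=
    fun t z hz => history_eq_of_mem_pathEvent hz t
  constructor
  · intro h
    refine ⟨(iidLaw ν).real (pathEvent σ coord y),
      ENNReal.toReal_pos h (measure_ne_top _ _), fun t => ?_⟩
    rw [← iidLaw_real_prefix hσ]
    exact measureReal_mono (hsub t)
  · rintro ⟨c, hc, h⟩ h0
    have hset : pathEvent σ coord y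
        = ⋂ t, {z : ℕ → S | history σ coord t z = prefixOf y t} := by
      refine Set.Subset.antisymm (Set.subset_iInter hsub) fun z hz t => ?_
      have := congrFun (Set.mem_iInter.1 hz (t + 1)) (Fin.last t)
      rw [history_apply] at this
      simpa [prefixOf] using this
    have hlim := tendsto_measure_iInter_atTop (μ := iidLaw ν)
      (s := fun t => {z : ℕ → S | history σ coord t z = prefixOf y t})
      (fun t => (measurable_history hσ measurable_coord t
        (measurableSet_singleton _)).nullMeasurableSet)
      (fun t t' htt' z hz => by
        simp only [Set.mem_ofPred_eq, history_eq_prefixOf_iff] at hz ⊢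
        exact fun i hi => hz i (hi.trans_le htt'))
      ⟨0, measure_ne_top _ _⟩
    rw [← hset, h0] at hlim
    have hlim' := (ENNReal.tendsto_toReal ENNReal.zero_ne_top).comp hlim
    have : c ≤ 0 := ge_of_tendsto' hlim' fun t => by
      have := h t
      rw [← iidLaw_real_prefix hσ] at this
      exact this
    linarith

end Canonical

/-! ### Informative signals: the right action is eventually chosen forever. -/

section Learning

variable {S : Type*} [MeasurableSpace S] {μ : State → Measure S} {μ₀ : Measure S}
  {σ : ∀ t, Strategy S t}

/-- Wherever an agent chooses `v`, the state `v` is at least as likely as the other one, signals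
being informative. -/
def Obedient (μ : State → Measure S) (σ : ∀ t, Strategy S t) : Prop :=
  ∀ (t : ℕ) (v : State) (B : Set ((Fin t → State) × S)), MeasurableSet B →
    (iidLaw (μ !v)).real {z | information σ coord t z ∈ B ∧ action σ coord t z = v}
      ≤ (iidLaw (μ v)).real {z | information σ coord t z ∈ B ∧ action σ coord t z = v}

/-- Probability that agent `t` errs when signals are informative and the state is `v`. -/
def errorProb (μ : State → Measure S) (σ : ∀ t, Strategy S t) (v : State) (t : ℕ) : ℝ :=
  (iidLaw (μ v)).real {z | action σ coord t z = !v}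

/-- Log-likelihood ratio of the state `v` against the other state. -/
def stateLLR (μ : State → Measure S) (v : State) : S → ℝ := llr (μ v) (μ !v)

lemma measurable_stateLLR (v : State) : Measurable (stateLLR μ v) := measurable_llr _ _

lemma IsInformationStructure.stateLLR_not (hμ : IsInformationStructure μ μ₀) (v : State) :
    stateLLR μ (!v) =ᵐ[μ v] fun a => -stateLLR μ v a := by
  have := hμ.isProbabilityMeasure
  filter_upwards [neg_llr (hμ.informative_ac v (!v))] with a ha
  simpa [stateLLR] using ha.symm

/-- A law that is mutually absolutely continuous with the informative signals and under which
log-likelihood ratios are atomless. -/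
structure IsRegularLaw (μ : State → Measure S) (ν : Measure S) : Prop where
  isProbabilityMeasure : IsProbabilityMeasure ν
  ac : ∀ v, ν ≪ μ v
  ac' : ∀ v, μ v ≪ ν
  continuous : Continuous (llrCDF μ ν)

lemma IsInformationStructure.isRegularLaw (hμ : IsInformationStructure μ μ₀) (v : State) :
    IsRegularLaw μ (μ v) :=
  ⟨hμ.isProbabilityMeasure v, hμ.informative_ac v, fun v' => hμ.informative_ac v' v,
    hμ.continuous_informative v⟩

lemma IsInformationStructure.isRegularLaw₀ (hμ : IsInformationStructure μ μ₀) :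
    IsRegularLaw μ μ₀ :=
  ⟨hμ.isProbabilityMeasure₀, hμ.uninformative_ac_informative, hμ.informative_ac_uninformative,
    hμ.continuous_uninformative⟩

/-- Lower tail of the log-likelihood ratio of `v` against the other state. -/
def tail (μ : State → Measure S) (ν : Measure S) (v : State) (x : ℝ) : ℝ :=
  ν.real {a | stateLLR μ v a ≤ -x}

lemma IsInformationStructure.tail_pos (hμ : IsInformationStructure μ μ₀) {ν : Measure S}
    (hν : IsRegularLaw μ ν) (v : State) (x : ℝ) : 0 < tail μ ν v x := by
  have := hν.isProbabilityMeasure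
  refine ENNReal.toReal_pos (fun h0 => ?_) (measure_ne_top _ _)
  have h1 : μ good {a | stateLLR μ v a ≤ -x} = 0 := hν.ac' good h0
  cases v with
  | true =>
    exact (hμ.unbounded_below x).ne' (measure_mono_null
      (fun a (ha : privateLLR μ a < -x) => (le_of_lt ha : stateLLR μ true a ≤ -x)) h1)
  | false =>
    refine (hμ.unbounded_above x).ne' ?_
    have h2 := hμ.stateLLR_not good
    refine le_antisymm ((measure_mono_ae ?_).trans h1.le) zero_le
    filter_upwards [h2] with a ha (hx : x < privateLLR μ a)
    change stateLLR μ false a ≤ -x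
    have h3 : stateLLR μ false a = -privateLLR μ a := ha
    linarith

/-- A continuous CDF has no atoms. Ties at the cutoff are therefore negligible, and no tie-breaking
rule is needed. -/
lemma measure_stateLLR_singleton {ν : Measure S} (hν : IsRegularLaw μ ν) (v : State)
    (hμ : IsInformationStructure μ μ₀) (x : ℝ) : ν {a | stateLLR μ v a = x} = 0 := by
  have := hν.isProbabilityMeasure
  have hm : Measurable (privateLLR μ) := measurable_llr _ _
  have hgood : ∀ x, ν {a | privateLLR μ a = x} = 0 := by
    intro x
    have hp : IsProbabilityMeasure (ν.map (privateLLR μ)) :=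
      Measure.isProbabilityMeasure_map hm.aemeasurable
    have h1 : (ν.map (privateLLR μ)) {x} = 0 := by
      rw [← measure_cdf (ν.map (privateLLR μ)), StieltjesFunction.measure_singleton]
      have hc : ContinuousAt (fun y => cdf (ν.map (privateLLR μ)) y) x := hν.continuous.continuousAt
      rw [(hc.continuousWithinAt.leftLim_eq), sub_self, ENNReal.ofReal_zero]
    rwa [Measure.map_apply hm (measurableSet_singleton x)] at h1
  cases v with
  | true => exact hgood x
  | false =>
    refine le_antisymm ((measure_mono_ae ?_).trans (hgood (-x)).le) zero_le
    filter_upwards [(hν.ac good).ae_le (hμ.stateLLR_not good)] with a ha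
      (hx : stateLLR μ false a = x)
    change privateLLR μ a = -x
    have h3 : stateLLR μ false a = -privateLLR μ a := ha
    linarith

/-- No strategy of agent `t` has a smaller total error probability than an obedient one. -/
lemma Obedient.sum_error_le (ho : Obedient μ σ) (hμ : IsInformationStructure μ μ₀)
    (hσ : ∀ t, Measurable (σ t)) (t : ℕ) {τ : Strategy S t} (hτ : Measurable τ) (v : State) :
    errorProb μ σ v t + errorProb μ σ (!v) t
      ≤ (iidLaw (μ v)).real {z | τ (information σ coord t z) = !v}
        + (iidLaw (μ !v)).real {z | τ (information σ coord t z) = v} := by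
  have := hμ.isProbabilityMeasure
  have hI := measurable_information hσ (measurable_coord (S := S)) t
  have ha := measurable_action hσ (measurable_coord (S := S)) t
  have hmτ : ∀ u, MeasurableSet {z : ℕ → S | τ (information σ coord t z) = u} :=
    fun u => (hτ.comp hI) (measurableSet_singleton u)
  have hma : ∀ u, MeasurableSet {z : ℕ → S | action σ coord t z = u} :=
    fun u => ha (measurableSet_singleton u)
  have hB : ∀ u, MeasurableSet {i : (Fin t → State) × S | τ i = u} :=
    fun u => hτ (measurableSet_singleton u)
  -- In each state, the two error events differ by the outcomes where exactly one of the two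
  -- strategies is right. Obedience on `τ = !v` and on `τ = v` compares these exchange terms across
  -- the two states.
  have key : ∀ v, errorProb μ σ v t
        + (iidLaw (μ v)).real {z | τ (information σ coord t z) = !v ∧ action σ coord t z = v}
      = (iidLaw (μ v)).real {z | τ (information σ coord t z) = !v}
        + (iidLaw (μ v)).real {z | τ (information σ coord t z) = v ∧ action σ coord t z = !v} := by
    intro v
    rw [errorProb, ← measureReal_inter_add_sdiff (s := {z | action σ coord t z = !v}) (hmτ v),
      ← measureReal_inter_add_sdiff (s := {z | τ (information σ coord t z) = !v}) (hma v)]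
    have e1 : {z : ℕ → S | action σ coord t z = !v} ∩ {z | τ (information σ coord t z) = v}
        = {z | τ (information σ coord t z) = v ∧ action σ coord t z = !v} := by
      ext z; exact and_comm
    have e2 : {z : ℕ → S | action σ coord t z = !v} \ {z | τ (information σ coord t z) = v}
        = {z | τ (information σ coord t z) = !v} \ {z | action σ coord t z = v} := by
      ext z
      simp only [Set.mem_sdiff, Set.mem_ofPred_eq, Bool.eq_not]
      exact and_comm
    have e3 : {z : ℕ → S | τ (information σ coord t z) = !v} ∩ {z | action σ coord t z = v}
        = {z | τ (information σ coord t z) = !v ∧ action σ coord t z = v} := rfl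
    rw [e1, e2, e3]
    ring
  have h1 := key v
  have h2 := key (!v)
  have o1 := ho t v _ (hB (!v))
  have o2 := ho t (!v) _ (hB v)
  simp only [Bool.not_not, Set.mem_ofPred_eq] at h2 o1 o2
  linarith

/-- The competing strategy copies the predecessor, except that it overrules `v` when the signal lies
in `A`. This adds at most the mass of `A` to the error in state `v`, and repairs the predecessor's
error in state `!v` whenever the signal lies in `A`, independently of the past. -/
lemma Obedient.errorProb_succ_le (ho : Obedient μ σ) (hμ : IsInformationStructure μ μ₀)
    (hσ : ∀ t, Measurable (σ t)) (t : ℕ) (v : State) {A : Set S} (hA : MeasurableSet A) :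
    errorProb μ σ v (t + 1) + errorProb μ σ (!v) (t + 1)
      ≤ errorProb μ σ v t + errorProb μ σ (!v) t
        + ((μ v).real A - errorProb μ σ (!v) t * (μ !v).real A) := by
  classical
  have := hμ.isProbabilityMeasure
  set τ : Strategy S (t + 1) := fun i =>
    if i.1 (Fin.last t) = v ∧ i.2 ∈ A then !v else i.1 (Fin.last t) with hτdef
  have hlast : Measurable fun i : (Fin (t + 1) → State) × S => i.1 (Fin.last t) :=
    (measurable_pi_apply _).comp measurable_fst
  have hτ : Measurable τ :=
    Measurable.ite ((hlast (measurableSet_singleton v)).inter (measurable_snd hA))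
      measurable_const hlast
  have hτa : ∀ z : ℕ → S, τ (information σ coord (t + 1) z)
      = if action σ coord t z = v ∧ z (t + 1) ∈ A then !v else action σ coord t z := by
    intro z
    simp [hτdef, information, history_apply]
  have hprod : ∀ ν : Measure S, IsProbabilityMeasure ν → ∀ u B, MeasurableSet B →
      (iidLaw ν).real {z | action σ coord t z = u ∧ z (t + 1) ∈ B}
        = (iidLaw ν).real {z | action σ coord t z = u} * ν.real B := by
    intro ν _ u B hB
    simpa [history_apply] using
      iidLaw_real_history_inter hσ ν (t + 1) {h | h (Fin.last t) = u} hB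
  have h1 : (iidLaw (μ v)).real {z | τ (information σ coord (t + 1) z) = !v}
      ≤ errorProb μ σ v t + (μ v).real A := by
    have hsub : {z : ℕ → S | τ (information σ coord (t + 1) z) = !v}
        ⊆ {z | action σ coord t z = !v} ∪ {z | action σ coord t z = v ∧ z (t + 1) ∈ A} := by
      intro z hz
      simp only [Set.mem_ofPred_eq, hτa] at hz
      by_cases hc : action σ coord t z = v ∧ z (t + 1) ∈ A
      · exact Or.inr hc
      · exact Or.inl (by simpa [hc] using hz)
    refine (measureReal_mono hsub).trans ((measureReal_union_le _ _).trans ?_)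
    rw [hprod _ inferInstance v A hA, errorProb]
    gcongr
    exact mul_le_of_le_one_left measureReal_nonneg measureReal_le_one
  have h2 : (iidLaw (μ !v)).real {z | τ (information σ coord (t + 1) z) = v}
      = errorProb μ σ (!v) t * (1 - (μ !v).real A) := by
    have hset : {z : ℕ → S | τ (information σ coord (t + 1) z) = v}
        = {z | action σ coord t z = v ∧ z (t + 1) ∈ Aᶜ} := by
      ext z
      simp only [Set.mem_ofPred_eq, hτa, Set.mem_compl_iff]
      by_cases hz : z (t + 1) ∈ A <;> by_cases hc : action σ coord t z = v <;> simp [hz, hc]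
    rw [hset, hprod _ inferInstance v _ hA.compl, errorProb, Bool.not_not,
      probReal_compl_eq_one_sub hA]
  have h3 := ho.sum_error_le hμ hσ (t + 1) hτ v
  rw [h2] at h3
  linarith

lemma errorProb_nonneg (v : State) (t : ℕ) : 0 ≤ errorProb μ σ v t := measureReal_nonneg

/-- With unbounded signals, error probabilities vanish. -/
lemma Obedient.tendsto_errorProb (ho : Obedient μ σ) (hμ : IsInformationStructure μ μ₀)
    (hσ : ∀ t, Measurable (σ t)) (v : State) :
    Tendsto (errorProb μ σ v) atTop (𝓝 0) := by
  have := hμ.isProbabilityMeasure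
  set e : ℕ → ℝ := fun t => errorProb μ σ (!v) t + errorProb μ σ v t with he
  have hstep : ∀ t {A : Set S}, MeasurableSet A →
      e (t + 1) ≤ e t + ((μ !v).real A - errorProb μ σ v t * (μ v).real A) := by
    intro t A hA
    simpa using ho.errorProb_succ_le hμ hσ t (!v) hA
  -- Pure imitation is the case `A = ∅`.
  have hanti : Antitone e := antitone_nat_of_succ_le fun t => by
    simpa using hstep t MeasurableSet.empty
  have hbdd : BddBelow (Set.range e) :=
    ⟨0, by rintro _ ⟨t, rfl⟩; exact add_nonneg (errorProb_nonneg _ _) (errorProb_nonneg _ _)⟩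
  have hlim := tendsto_atTop_ciInf hanti hbdd
  have hdiff : Tendsto (fun t => e t - e (t + 1)) atTop (𝓝 0) := by
    simpa using hlim.sub (hlim.comp (tendsto_add_atTop_nat 1))
  rw [Metric.tendsto_atTop']
  intro δ hδ
  -- On signals with likelihood ratio at most `δ / 2` against `v`, overruling costs at most half of
  -- what it gains when the error is at least `δ`. Each such period would lower `e` by a fixed
  -- positive amount, contrary to its convergence.
  set M := -Real.log (δ / 2) with hM
  set A : Set S := {a | stateLLR μ (!v) a ≤ -M} with hA
  have hAm : MeasurableSet A := measurable_stateLLR _ measurableSet_Iic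
  have hc : 0 < (μ v).real A := hμ.tail_pos (hμ.isRegularLaw v) (!v) M
  have hle : (μ !v).real A ≤ δ / 2 * (μ v).real A := by
    have h1 := real_le_exp_mul_of_llr_le (hμ.informative_ac (!v) v) (hμ.informative_ac v (!v))
      hAm (c := -M) (by simp [hA, stateLLR])
    rwa [hM, neg_neg, Real.exp_log (by positivity)] at h1
  obtain ⟨N, hN⟩ := (hdiff.eventually_lt_const
    (show 0 < δ / 2 * (μ v).real A by positivity)).exists_forall_of_atTop
  refine ⟨N, fun t ht => ?_⟩
  rw [Real.dist_eq, sub_zero, abs_of_nonneg (errorProb_nonneg _ _)]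
  have h1 := hN t ht.le
  have h2 := hstep t hAm
  by_contra! hge
  nlinarith

/-- Either agent `T` errs, or there is a first later switch from `v` to `!v`. By obedience the
switch is at least as likely in state `!v`, and there it requires agent `T` to have chosen `v`,
which is an error. -/
lemma Obedient.measure_exists_error_le (ho : Obedient μ σ) (hμ : IsInformationStructure μ μ₀)
    (hσ : ∀ t, Measurable (σ t)) (v : State) (T : ℕ) :
    (iidLaw (μ v)).real {z | ∃ t ≥ T, action σ coord t z = !v}
      ≤ errorProb μ σ v T + errorProb μ σ (!v) T := by
  have := hμ.isProbabilityMeasure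
  -- The first switch after `T` happens at `T + k + 1`; an error at `T` itself is counted
  -- separately.
  set D : ℕ → Set (ℕ → S) := fun k =>
    {z | (∀ t, T ≤ t → t < T + k + 1 → action σ coord t z = v)
      ∧ action σ coord (T + k + 1) z = !v} with hD
  have hma := measurable_action hσ (measurable_coord (S := S))
  have hmD : ∀ k, MeasurableSet (D k) := fun k => by
    refine MeasurableSet.inter
      (s₁ := {z | ∀ t, T ≤ t → t < T + k + 1 → action σ coord t z = v}) ?_
      (hma _ (measurableSet_singleton (!v)))
    simp only [Set.ofPred_forall]
    exact MeasurableSet.iInter fun t => MeasurableSet.iInter fun _ => MeasurableSet.iInter fun _ =>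
      hma t (measurableSet_singleton _)
  have hdisj : Pairwise (Function.onFun Disjoint D) := by
    have hlt : ∀ k l, k < l → Disjoint (D k) (D l) := by
      intro k l hkl
      refine Set.disjoint_left.2 fun z hk hl => ?_
      have h1 := hl.1 (T + k + 1) (by omega) (by omega)
      rw [hk.2] at h1
      exact Bool.not_ne_self v h1
    intro k l hkl
    rcases lt_or_gt_of_ne hkl with h | h
    exacts [hlt k l h, (hlt l k h).symm]
  have hDle : ∀ k, iidLaw (μ v) (D k) ≤ iidLaw (μ !v) (D k) := by
    intro k
    have h1 := ho (T + k + 1) (!v)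
      {i | ∀ j : Fin (T + k + 1), T ≤ (j : ℕ) → i.1 j = v} (by
        simp only [Set.ofPred_forall]
        exact MeasurableSet.iInter fun j => MeasurableSet.iInter fun _ =>
          measurableSet_eq_fun (by fun_prop) measurable_const)
    have hset : {z : ℕ → S | information σ coord (T + k + 1) z ∈
          {i : (Fin (T + k + 1) → State) × S | ∀ j : Fin (T + k + 1), T ≤ (j : ℕ) → i.1 j = v}
          ∧ action σ coord (T + k + 1) z = !v} = D k := by
      ext z
      simp only [Set.mem_ofPred_eq, hD, information, history_apply]
      refine and_congr_left fun _ => ⟨fun h t h1 h2 => h ⟨t, h2⟩ h1, fun h j hj => h j hj j.2⟩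
    rw [hset, Bool.not_not] at h1
    exact (ENNReal.toReal_le_toReal (measure_ne_top _ _) (measure_ne_top _ _)).1 h1
  have hU : iidLaw (μ v) (⋃ k, D k) ≤ iidLaw (μ !v) (⋃ k, D k) := by
    rw [measure_iUnion hdisj hmD, measure_iUnion hdisj hmD]
    exact ENNReal.tsum_le_tsum hDle
  have hU' : (iidLaw (μ v)).real (⋃ k, D k) ≤ errorProb μ σ (!v) T := by
    refine (ENNReal.toReal_mono (measure_ne_top _ _) hU).trans (measureReal_mono ?_)
    refine Set.iUnion_subset fun k z hz => ?_
    simpa using hz.1 T le_rfl (by omega)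
  have hsub : {z : ℕ → S | ∃ t ≥ T, action σ coord t z = !v}
      ⊆ {z | action σ coord T z = !v} ∪ ⋃ k, D k := by
    classical
    intro z hz
    have hz' : ∃ t, T ≤ t ∧ action σ coord t z = !v := hz
    by_cases h0 : Nat.find hz' = T
    · exact Or.inl (h0 ▸ (Nat.find_spec hz').2)
    · right
      obtain ⟨h1, h2⟩ := Nat.find_spec hz'
      refine Set.mem_iUnion.2 ⟨Nat.find hz' - T - 1, ?_⟩
      have hk : T + (Nat.find hz' - T - 1) + 1 = Nat.find hz' := by omega
      simp only [hD, hk, Set.mem_ofPred_eq]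
      refine ⟨fun t ht1 ht2 => ?_, h2⟩
      have h3 := Nat.find_min hz' ht2
      simpa [ht1] using h3
  calc (iidLaw (μ v)).real {z | ∃ t ≥ T, action σ coord t z = !v}
      ≤ (iidLaw (μ v)).real ({z | action σ coord T z = !v} ∪ ⋃ k, D k) := measureReal_mono hsub
    _ ≤ (iidLaw (μ v)).real {z | action σ coord T z = !v} + (iidLaw (μ v)).real (⋃ k, D k) :=
        measureReal_union_le _ _
    _ ≤ errorProb μ σ v T + errorProb μ σ (!v) T := by
        rw [errorProb]; gcongr

/-- With informative signals, almost surely all but finitely many agents choose the right action. -/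
lemma Obedient.measure_compl_eventuallyActs (ho : Obedient μ σ) (hμ : IsInformationStructure μ μ₀)
    (hσ : ∀ t, Measurable (σ t)) (v : State) :
    iidLaw (μ v) (eventuallyActs σ coord v)ᶜ = 0 := by
  have := hμ.isProbabilityMeasure
  have h1 : ∀ T, (iidLaw (μ v)).real (eventuallyActs σ coord v)ᶜ
      ≤ errorProb μ σ v T + errorProb μ σ (!v) T := by
    intro T
    refine (measureReal_mono fun z hz => ?_).trans (ho.measure_exists_error_le hμ hσ v T)
    by_contra hne
    refine hz ⟨T, fun t ht => ?_⟩
    by_contra hav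
    exact hne ⟨t, ht, Bool.eq_not.2 hav⟩
  have h2 := ge_of_tendsto' ((ho.tendsto_errorProb hμ hσ v).add (ho.tendsto_errorProb hμ hσ (!v))) h1
  rw [add_zero] at h2
  exact (measureReal_eq_zero_iff).1 (le_antisymm h2 measureReal_nonneg)

lemma Obedient.measure_eventuallyActs_not (ho : Obedient μ σ) (hμ : IsInformationStructure μ μ₀)
    (hσ : ∀ t, Measurable (σ t)) (v : State) :
    iidLaw (μ v) (eventuallyActs σ coord (!v)) = 0 := by
  refine measure_mono_null ?_ (ho.measure_compl_eventuallyActs hμ hσ v)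
  rintro z ⟨T, hT⟩ ⟨T', hT'⟩
  have h1 := hT _ (le_max_left T T')
  rw [hT' _ (le_max_right T T')] at h1
  exact Bool.not_ne_self v h1.symm

end Learning

/-! ### Cutoff strategies and the probability of a herd. -/

section Cutoff

variable {S : Type*} [MeasurableSpace S] {μ : State → Measure S} {μ₀ : Measure S}
  {σ : ∀ t, Strategy S t}

/-- Public log-likelihood ratio of `v` against the other state after `t` actions as in `y`. -/
def publicLLR (μ : State → Measure S) (σ : ∀ t, Strategy S t) (y : ℕ → State) (v : State)
    (t : ℕ) : ℝ :=
  Real.log (prefixProb σ (μ v) y t / prefixProb σ (μ !v) y t)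

lemma prefixProb_pos_of_pos {ν ν' : Measure S} (hν : IsRegularLaw μ ν) (hν' : IsRegularLaw μ ν')
    {y : ℕ → State} {t : ℕ} (h : 0 < prefixProb σ ν y t) : 0 < prefixProb σ ν' y t := by
  have := hν'.isProbabilityMeasure
  refine Finset.prod_pos fun i hi => ENNReal.toReal_pos (fun h0 => h.ne' ?_) (measure_ne_top _ _)
  refine Finset.prod_eq_zero hi ?_
  rw [measureReal_def, ((hν.ac good).trans (hν'.ac' good)) h0, ENNReal.toReal_zero]

lemma Obedient.prefixProb_mul_le (ho : Obedient μ σ) (hμ : IsInformationStructure μ μ₀)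
    (hσ : ∀ t, Measurable (σ t)) (y : ℕ → State) (t : ℕ) (u : State) {D : Set S}
    (hD : MeasurableSet D) (hDu : ∀ a ∈ D, σ t (prefixOf y t, a) = u) :
    prefixProb σ (μ !u) y t * (μ !u).real D ≤ prefixProb σ (μ u) y t * (μ u).real D := by
  have := hμ.isProbabilityMeasure
  have h1 := ho t u ({prefixOf y t} ×ˢ D) ((measurableSet_singleton _).prod hD)
  have hset : {z : ℕ → S | information σ coord t z ∈ ({prefixOf y t} : Set (Fin t → State)) ×ˢ D
      ∧ action σ coord t z = u} = {z | history σ coord t z = prefixOf y t ∧ z t ∈ D} := by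
    ext z
    simp only [Set.mem_ofPred_eq, information, action, Set.mem_prod, Set.mem_singleton_iff]
    refine ⟨fun h => h.1, fun h => ⟨h, ?_⟩⟩
    rw [h.1]
    exact hDu _ h.2
  rw [hset, iidLaw_real_prefix_inter hσ _ y t hD, iidLaw_real_prefix_inter hσ _ y t hD] at h1
  exact h1

/-- On this set the private evidence for `!u` outweighs the public evidence for `u` pointwise, while
obedience says that it does not on average. -/
lemma Obedient.measure_disobey_eq_zero (ho : Obedient μ σ) (hμ : IsInformationStructure μ μ₀)
    (hσ : ∀ t, Measurable (σ t)) {y : ℕ → State} {t : ℕ}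
    (hp : ∀ v, 0 < prefixProb σ (μ v) y t) (u : State) :
    μ u {a | σ t (prefixOf y t, a) = u ∧ publicLLR μ σ y u t < stateLLR μ (!u) a} = 0 := by
  have := hμ.isProbabilityMeasure
  have hD : MeasurableSet
      {a | σ t (prefixOf y t, a) = u ∧ publicLLR μ σ y u t < stateLLR μ (!u) a} :=
    (((hσ t).comp measurable_prodMk_left) (measurableSet_singleton u)).inter
      (measurable_stateLLR (!u) measurableSet_Ioi)
  refine measure_eq_zero_of_lt_llr (hμ.informative_ac (!u) u) (hμ.informative_ac u (!u)) hD
    (c := publicLLR μ σ y u t) ?_ ?_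
  · intro a ha
    simpa [stateLLR] using ha.2
  · have h1 := ho.prefixProb_mul_le hμ hσ y t u hD fun a ha => ha.1
    rw [publicLLR, Real.exp_log (div_pos (hp u) (hp _)), div_mul_eq_mul_div,
      le_div_iff₀ (hp _), mul_comm]
    exact h1

/-- Agents follow a cutoff rule in the private log-likelihood ratio. -/
lemma Obedient.measure_compl_continuing (ho : Obedient μ σ) (hμ : IsInformationStructure μ μ₀)
    (hσ : ∀ t, Measurable (σ t)) {y : ℕ → State} {t : ℕ}
    (hp : ∀ v, 0 < prefixProb σ (μ v) y t) {v : State} (hv : y t = v) {ν : Measure S}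
    (hν : IsRegularLaw μ ν) :
    ν.real (continuing σ y t)ᶜ = tail μ ν v (publicLLR μ σ y v t) := by
  have h1 := hν.ac (!v) (ho.measure_disobey_eq_zero hμ hσ hp (!v))
  -- Disobedience is excluded in both directions: `h1` forces every deviating signal below the
  -- cutoff, `h2` every continuing one weakly above it, and `h3` removes ties. Absolute continuity
  -- carries all three to `ν`.
  have h2 := hν.ac v (ho.measure_disobey_eq_zero hμ hσ hp v)
  have h3 := measure_stateLLR_singleton hν v hμ (-publicLLR μ σ y v t)
  have h4 := (hν.ac v).ae_le (hμ.stateLLR_not v)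
  have hneg : publicLLR μ σ y (!v) t = -publicLLR μ σ y v t := by
    rw [publicLLR, publicLLR, Bool.not_not, ← Real.log_inv, inv_div]
  rw [hneg, Bool.not_not] at h1
  refine measureReal_congr ?_
  filter_upwards [measure_eq_zero_iff_ae_notMem.1 h1, measure_eq_zero_iff_ae_notMem.1 h2,
    measure_eq_zero_iff_ae_notMem.1 h3, h4] with a k1 k2 k3 k4
  simp only [not_and, not_lt] at k1 k2
  refine propext (Iff.intro (fun (ha : ¬ σ t (prefixOf y t, a) = y t) => ?_)
    fun (ha : stateLLR μ v a ≤ _) => ?_)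
  · exact k1 (Bool.eq_not.2 (hv ▸ ha))
  · intro (hc : σ t (prefixOf y t, a) = y t)
    have := k2 (hc.trans hv)
    rw [k4] at this
    exact k3 (le_antisymm ha (by linarith))

lemma tail_antitone {ν : Measure S} (hν : IsRegularLaw μ ν) (v : State) :
    Antitone (tail μ ν v) := by
  have := hν.isProbabilityMeasure
  intro x x' hx
  exact measureReal_mono fun a (ha : _ ≤ -x') => (le_trans ha (neg_le_neg hx) : _ ≤ -x)

/-- If the tail of `ν'` is dominated by that of `ν`, then a herd that has positive probability under
`ν` has positive probability under `ν'`. -/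
lemma Obedient.measure_pathEvent_ne_zero (ho : Obedient μ σ) (hμ : IsInformationStructure μ μ₀)
    (hσ : ∀ t, Measurable (σ t)) {ν ν' : Measure S} (hν : IsRegularLaw μ ν)
    (hν' : IsRegularLaw μ ν') {v : State} {C : ℝ}
    (hC : ∀ᶠ x in atTop, tail μ ν' v x ≤ C * tail μ ν v x) {y : ℕ → State} {T : ℕ}
    (hy : ∀ t ≥ T, y t = v) (hpos : iidLaw ν (pathEvent σ coord y) ≠ 0) :
    iidLaw ν' (pathEvent σ coord y) ≠ 0 := by
  have := hν.isProbabilityMeasure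
  have := hν'.isProbabilityMeasure
  obtain ⟨c, hc, hcle⟩ := (pathEvent_pos_iff hσ ν y).1 hpos
  have hp : ∀ {κ : Measure S}, IsRegularLaw μ κ → ∀ t, 0 < prefixProb σ κ y t :=
    fun hκ t => prefixProb_pos_of_pos hν hκ (hc.trans_le (hcle t))
  have hcut : ∀ {κ : Measure S}, IsRegularLaw μ κ → ∀ t ≥ T,
      1 - κ.real (continuing σ y t) = tail μ κ v (publicLLR μ σ y v t) := by
    intro κ hκ t ht
    have := hκ.isProbabilityMeasure
    rw [← probReal_compl_eq_one_sub (measurableSet_continuing hσ y t)]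
    exact ho.measure_compl_continuing hμ hσ (fun u => hp (hμ.isRegularLaw u) t) (hy t ht) hκ
  have hsum : Summable fun t => 1 - ν.real (continuing σ y t) :=
    summable_one_sub_of_le_prod (fun _ => measureReal_le_one) (fun _ => measureReal_nonneg) hc hcle
  -- The summable tails tend to zero, while the tail at any fixed level is positive; monotonicity
  -- pushes the public ratio past every level, where the tail comparison `hC` applies.
  have hr : Tendsto (publicLLR μ σ y v) atTop atTop := by
    refine tendsto_atTop.2 fun M => ?_
    filter_upwards [hsum.tendsto_atTop_zero.eventually_lt_const (hμ.tail_pos hν v M),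
      eventually_ge_atTop T] with t ht htT
    rw [hcut hν t htT] at ht
    exact ((tail_antitone hν v).reflect_lt ht).le
  have hsum' : Summable fun t => 1 - ν'.real (continuing σ y t) := by
    refine Summable.of_norm_bounded_eventually_nat (hsum.mul_left C) ?_
    filter_upwards [hr.eventually hC, eventually_ge_atTop T] with t ht htT
    rw [Real.norm_of_nonneg (sub_nonneg.2 measureReal_le_one), hcut hν t htT, hcut hν' t htT]
    exact ht
  refine (pathEvent_pos_iff hσ ν' y).2
    (exists_pos_le_prod_of_summable (fun _ => measureReal_le_one) (fun t => ?_) hsum')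
  -- Summable defects do not prevent a zero factor; positivity of the prefix probabilities, shared
  -- by equivalent laws, does.
  have h := hp hν' (t + 1)
  rw [prefixProb, Finset.prod_range_succ] at h
  exact pos_of_mul_pos_right h (hp hν' t).le

end Cutoff

/-! ### Tail conditions and their effect on herds. -/

section Tails

variable {S : Type*} [MeasurableSpace S] {μ : State → Measure S} {μ₀ : Measure S}
  {σ : ∀ t, Strategy S t}

lemma llrCDF_eq_real {ν : Measure S} [IsProbabilityMeasure ν] (x : ℝ) :
    llrCDF μ ν x = ν.real {a | privateLLR μ a ≤ x} := by
  have hm : Measurable (privateLLR μ) := measurable_llr _ _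
  have : IsProbabilityMeasure (ν.map (privateLLR μ)) :=
    Measure.isProbabilityMeasure_map hm.aemeasurable
  rw [llrCDF, cdf_eq_real, map_measureReal_apply hm measurableSet_Iic]
  rfl

lemma llrCDF_neg_eq_tail {ν : Measure S} (hν : IsRegularLaw μ ν) (x : ℝ) :
    llrCDF μ ν (-x) = tail μ ν good x := by
  have := hν.isProbabilityMeasure
  exact llrCDF_eq_real _

lemma IsInformationStructure.one_sub_llrCDF_eq_tail (hμ : IsInformationStructure μ μ₀)
    {ν : Measure S} (hν : IsRegularLaw μ ν) (x : ℝ) :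
    1 - llrCDF μ ν x = tail μ ν bad x := by
  have := hν.isProbabilityMeasure
  have hm : Measurable (privateLLR μ) := measurable_llr _ _
  rw [llrCDF_eq_real, ← probReal_compl_eq_one_sub (s := {a | privateLLR μ a ≤ x})
    (hm measurableSet_Iic), tail]
  refine measureReal_congr ?_
  filter_upwards [(hν.ac good).ae_le (hμ.stateLLR_not good),
    measure_eq_zero_iff_ae_notMem.1 (measure_stateLLR_singleton hν good hμ x)] with a h1 h2
  have h3 : stateLLR μ false a = -privateLLR μ a := h1
  have h4 : privateLLR μ a ≠ x := h2
  refine propext (Iff.intro (fun (ha : ¬ privateLLR μ a ≤ x) => ?_)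
    fun (ha : stateLLR μ false a ≤ -x) => ?_)
  · change stateLLR μ false a ≤ -x
    linarith
  · intro (hle : privateLLR μ a ≤ x)
    exact h4 (le_antisymm hle (by linarith))

/-- The informative law compared with `μ₀` is that of the state opposite to the action: this is what
turns a herd under `μ₀` into a wrong herd under informative signals. -/
lemma FatterTails.exists_tail_le (h : FatterTails μ μ₀) (hμ : IsInformationStructure μ μ₀) :
    ∃ C : ℝ, ∀ v, ∀ᶠ x in atTop, tail μ (μ !v) v x ≤ C * tail μ μ₀ v x := by
  obtain ⟨ε, hε, hL, hR⟩ := h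
  have key : ∀ {a b : ℝ}, 0 < b → ε ≤ a / b → b ≤ ε⁻¹ * a := by
    intro a b hb hab
    rw [le_div_iff₀ hb] at hab
    rwa [inv_mul_eq_div, le_div_iff₀ hε, mul_comm]
  refine ⟨ε⁻¹, fun v => ?_⟩
  cases v with
  | true =>
    filter_upwards [hL] with x hx
    rw [leftRatio, llrCDF_neg_eq_tail hμ.isRegularLaw₀,
      llrCDF_neg_eq_tail (hμ.isRegularLaw bad)] at hx
    exact key (hμ.tail_pos (hμ.isRegularLaw bad) _ _) hx
  | false =>
    filter_upwards [hR] with x hx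
    rw [rightRatio, hμ.one_sub_llrCDF_eq_tail hμ.isRegularLaw₀,
      hμ.one_sub_llrCDF_eq_tail (hμ.isRegularLaw good)] at hx
    exact key (hμ.tail_pos (hμ.isRegularLaw good) _ _) hx

/-- Here the informative law is that of the state matching the action, so that correct herds
transfer to `μ₀`. One action suffices. -/
lemma ThinnerTails.exists_tail_le (h : ThinnerTails μ μ₀) (hμ : IsInformationStructure μ μ₀) :
    ∃ (v : State) (C : ℝ), ∀ᶠ x in atTop, tail μ μ₀ v x ≤ C * tail μ (μ v) v x := by
  obtain ⟨ε, hε, hL | hR⟩ := h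
  · refine ⟨good, 1 / ε, ?_⟩
    filter_upwards [hL] with x hx
    rwa [leftRatio, llrCDF_neg_eq_tail hμ.isRegularLaw₀,
      llrCDF_neg_eq_tail (hμ.isRegularLaw good),
      div_le_iff₀ (hμ.tail_pos (hμ.isRegularLaw good) _ _)] at hx
  · refine ⟨bad, 1 / ε, ?_⟩
    filter_upwards [hR] with x hx
    rwa [rightRatio, hμ.one_sub_llrCDF_eq_tail hμ.isRegularLaw₀,
      hμ.one_sub_llrCDF_eq_tail (hμ.isRegularLaw bad),
      div_le_iff₀ (hμ.tail_pos (hμ.isRegularLaw bad) _ _)] at hx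

/-- With fatter tails, uninformative signals almost surely prevent herds. -/
lemma Obedient.measure_eventuallyActs_of_fatterTails (ho : Obedient μ σ)
    (hμ : IsInformationStructure μ μ₀) (hσ : ∀ t, Measurable (σ t)) (h : FatterTails μ μ₀)
    (v : State) : iidLaw μ₀ (eventuallyActs σ coord v) = 0 := by
  obtain ⟨C, hC⟩ := h.exists_tail_le hμ
  rw [eventuallyActs_eq_iUnion, measure_iUnion_null_iff]
  intro T
  rw [measure_iUnion_null_iff]
  intro w
  by_contra hne
  -- The path ends in `v`, so under `μ (!v)` it is a wrong herd and has probability zero.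
  refine ho.measure_pathEvent_ne_zero hμ hσ hμ.isRegularLaw₀ (hμ.isRegularLaw (!v)) (hC v)
    (fun t ht => extend_of_le w v ht) hne (measure_mono_null ?_
      (ho.measure_eventuallyActs_not hμ hσ (!v)))
  rw [Bool.not_not, eventuallyActs_eq_iUnion]
  exact Set.subset_iUnion₂ (s := fun T (w : Fin T → State) => pathEvent σ coord (extend w v)) T w

/-- With thinner tails, some herd has positive probability both with informative and with
uninformative signals. -/
lemma Obedient.exists_pathEvent_of_thinnerTails (ho : Obedient μ σ)
    (hμ : IsInformationStructure μ μ₀) (hσ : ∀ t, Measurable (σ t)) (h : ThinnerTails μ μ₀) :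
    ∃ (v : State) (y : ℕ → State), iidLaw (μ v) (pathEvent σ coord y) ≠ 0
      ∧ iidLaw μ₀ (pathEvent σ coord y) ≠ 0 := by
  obtain ⟨v, C, hC⟩ := h.exists_tail_le hμ
  have := hμ.isProbabilityMeasure
  have h1 : iidLaw (μ v) (eventuallyActs σ coord v) ≠ 0 := by
    intro h0
    have h2 := measure_union_null h0 (ho.measure_compl_eventuallyActs hμ hσ v)
    rw [Set.union_compl_self, measure_univ] at h2
    exact one_ne_zero h2
  have h2 : ∃ (T : ℕ) (w : Fin T → State),
      iidLaw (μ v) (pathEvent σ coord (extend w v)) ≠ 0 := by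
    by_contra! hall
    refine h1 ?_
    rw [eventuallyActs_eq_iUnion, measure_iUnion_null_iff]
    exact fun T => measure_iUnion_null_iff.2 (hall T)
  obtain ⟨T, w, hw⟩ := h2
  exact ⟨v, extend w v, hw, ho.measure_pathEvent_ne_zero hμ hσ (hμ.isRegularLaw v)
    hμ.isRegularLaw₀ hC (fun t ht => extend_of_le w v ht) hw⟩

end Tails

/-! ### The observer's belief along a history. -/

section Belief

variable {Ω S : Type*} [MeasurableSpace Ω] {P : Measure Ω} {ω : Ω → Fin 2} {s : ℕ → Ω → S}
  {σ : ∀ t, Strategy S t}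

/-- The belief depends on the history only. -/
lemma belief_eq_of_history_eq {t : ℕ} {x x' : Ω} (h : history σ s t x = history σ s t x') :
    belief P ω s σ t x = belief P ω s σ t x' := by
  have hmeas : Measurable[MeasurableSpace.comap (history σ s t) inferInstance]
      (belief P ω s σ t) := stronglyMeasurable_condExp.measurable
  obtain ⟨B, -, hB⟩ := hmeas (measurableSet_singleton (belief P ω s σ t x))
  have h1 : x ∈ history σ s t ⁻¹' B := by rw [hB]; rfl
  have h2 : x' ∈ history σ s t ⁻¹' B := by rwa [Set.mem_preimage, ← h]
  rw [hB] at h2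
  exact (show belief P ω s σ t x' = belief P ω s σ t x from h2).symm

end Belief

/-! ### From the equilibrium to obedience, and the two halves of the theorem. -/

section Equilibrium

variable {Ω S : Type*} [MeasurableSpace Ω] [MeasurableSpace S] {P : Measure Ω} {γ : ℝ}
  {μ : State → Measure S} {μ₀ : Measure S}
  {θ : Ω → State} {ω : Ω → Fin 2} {s : ℕ → Ω → S} {σ : ∀ t, Strategy S t}

lemma IsSignalProcess.measurable_signals (hm : IsSignalProcess P γ μ μ₀ θ ω s) :
    Measurable fun x i => s i x :=
  measurable_pi_iff.2 hm.measurable_signal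

lemma IsSignalProcess.measurableSet_type (hm : IsSignalProcess P γ μ μ₀ θ ω s) (w : Fin 2)
    (v : State) : MeasurableSet (ω ⁻¹' {w} ∩ θ ⁻¹' {v}) :=
  (hm.measurable_source (measurableSet_singleton w)).inter
    (hm.measurable_state (measurableSet_singleton v))

lemma IsSignalProcess.prob_type (hm : IsSignalProcess P γ μ μ₀ θ ω s) (w : Fin 2) (v : State) :
    P.real (ω ⁻¹' {w} ∩ θ ⁻¹' {v}) = P.real (ω ⁻¹' {w}) / 2 := by
  have h := hm.indep_state_source.measure_inter_preimage_eq_mul {v} {w}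
    (measurableSet_singleton v) (measurableSet_singleton w)
  rw [Set.inter_comm, measureReal_def, h, ENNReal.toReal_mul, ← measureReal_def,
    ← measureReal_def, hm.prob_state]
  ring

variable [IsProbabilityMeasure P]

lemma IsSignalProcess.prob_source_pos (hm : IsSignalProcess P γ μ μ₀ θ ω s)
    (hγ : γ ∈ Set.Ioo (0 : ℝ) 1) (w : Fin 2) : 0 < P.real (ω ⁻¹' {w}) := by
  match w with
  | 1 => rw [hm.prob_source]; exact hγ.1
  | 0 =>
    have hc : ω ⁻¹' {0} = (ω ⁻¹' {1})ᶜ := by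
      ext x
      simp only [Set.mem_preimage, Set.mem_singleton_iff, Set.mem_compl_iff]
      omega
    rw [hc, probReal_compl_eq_one_sub (hm.measurable_source (measurableSet_singleton 1)),
      hm.prob_source]
    linarith [hγ.2]

lemma IsSignalProcess.prob_type_inter (hm : IsSignalProcess P γ μ μ₀ θ ω s)
    (w : Fin 2) (v : State) {E : Set (ℕ → S)} (hE : MeasurableSet E) :
    P.real (ω ⁻¹' {w} ∩ θ ⁻¹' {v} ∩ (fun x i => s i x) ⁻¹' E)
      = P.real (ω ⁻¹' {w}) / 2 * (iidLaw (signalLaw μ μ₀ w v)).real E := by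
  have hlaw := (hm.indep_signal w v).map_fun_eq_infinitePi_map hm.measurable_signal
  simp only [hm.law_signal] at hlaw
  rw [iidLaw, ← hlaw, map_measureReal_apply hm.measurable_signals hE, ← hm.prob_type w v,
    measureReal_def, measureReal_def, measureReal_def, ← ENNReal.toReal_mul, mul_comm,
    cond_mul_eq_inter (hm.measurableSet_type w v)]

/-- The `μ₀` term is the same in both states, so it drops out of every comparison between them. -/
lemma IsSignalProcess.prob_state_inter (hm : IsSignalProcess P γ μ μ₀ θ ω s)
    (v : State) {E : Set (ℕ → S)} (hE : MeasurableSet E) :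
    P.real ((fun x i => s i x) ⁻¹' E ∩ θ ⁻¹' {v})
      = P.real (ω ⁻¹' {1}) / 2 * (iidLaw (μ v)).real E
        + P.real (ω ⁻¹' {0}) / 2 * (iidLaw μ₀).real E := by
  have h1 := hm.prob_type_inter 1 v hE
  have h0 := hm.prob_type_inter 0 v hE
  simp only [signalLaw, if_true, zero_ne_one, if_false] at h0 h1
  rw [← h0, ← h1, ← measureReal_inter_add_sdiff (s := (fun x i => s i x) ⁻¹' E ∩ θ ⁻¹' {v})
    (hm.measurable_source (measurableSet_singleton 1))]
  congr 2
  · ext x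
    simp only [Set.mem_inter_iff]
    tauto
  · ext x
    have : ω x ≠ 1 ↔ ω x = 0 := by omega
    simp only [Set.mem_inter_iff, Set.mem_sdiff, Set.mem_preimage, Set.mem_singleton_iff, this]
    tauto

lemma IsEquilibrium.prob_match_le (he : IsEquilibrium P θ s σ)
    (hm : IsSignalProcess P γ μ μ₀ θ ω s) (t : ℕ) {τ : Strategy S t} (hτ : Measurable τ) :
    P.real {x | τ (information σ s t x) = θ x} ≤ P.real {x | action σ s t x = θ x} := by
  have hI := measurable_information he.measurable hm.measurable_signal t
  have hset : ∀ {τ : Strategy S t}, Measurable τ →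
      MeasurableSet {x | τ (information σ s t x) = θ x} := fun hτ =>
    measurableSet_eq_fun (hτ.comp hI) hm.measurable_state
  have hpay : ∀ {τ : Strategy S t}, Measurable τ →
      ∫ x, payoff θ σ s t τ x ∂P = P.real {x | τ (information σ s t x) = θ x} := by
    intro τ hτ
    have hind : payoff θ σ s t τ
        = {x | τ (information σ s t x) = θ x}.indicator (fun _ => (1 : ℝ)) := by
      funext x
      simp [payoff, Set.indicator_apply]
    rw [hind, integral_indicator_const _ (hset hτ)]
    simp
  rw [← hpay hτ, ← integral_condExp hI.comap_le]
  change _ ≤ P.real {x | σ t (information σ s t x) = θ x}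
  rw [← hpay (he.measurable t), ← integral_condExp (f := payoff θ σ s t (σ t)) hI.comap_le]
  exact integral_mono_ae integrable_condExp integrable_condExp (he.optimal t τ hτ)

/-- Test the equilibrium against flipping the action exactly where it is `v` and the information
lies in `B`. Only outcomes in that event matter, and the contribution of `ω = 0` cancels between the
two states. -/
lemma IsEquilibrium.obedient (he : IsEquilibrium P θ s σ)
    (hm : IsSignalProcess P γ μ μ₀ θ ω s) (hγ : γ ∈ Set.Ioo (0 : ℝ) 1) : Obedient μ σ := by
  classical
  intro t v B hB
  set D : Set (ℕ → S) := {z | information σ coord t z ∈ B ∧ action σ coord t z = v} with hD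
  have hI := measurable_information he.measurable (measurable_coord (S := S)) t
  have ha := measurable_action he.measurable (measurable_coord (S := S)) t
  have hDm : MeasurableSet D := (hI hB).inter (ha (measurableSet_singleton v))
  set D' : Set Ω := (fun x i => s i x) ⁻¹' D with hD'
  have hD'm : MeasurableSet D' := hm.measurable_signals hDm
  have hD'iff : ∀ x, x ∈ D' ↔ information σ s t x ∈ B ∧ action σ s t x = v := by
    intro x
    rw [information_eq_coord, action_eq_coord]
    rfl
  set τ : Strategy S t := fun i => if i ∈ B ∧ σ t i = v then !v else σ t i with hτdef
  have hτ : Measurable τ := Measurable.ite (hB.inter (he.measurable t (measurableSet_singleton v)))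
    measurable_const (he.measurable t)
  have h1 := he.prob_match_le hm t hτ
  rw [← measureReal_inter_add_sdiff (s := {x | τ (information σ s t x) = θ x}) hD'm,
    ← measureReal_inter_add_sdiff (s := {x | action σ s t x = θ x}) hD'm] at h1
  have e1 : {x | τ (information σ s t x) = θ x} ∩ D' = D' ∩ θ ⁻¹' {!v} := by
    ext x
    rw [Set.inter_comm]
    refine and_congr_right fun hx => ?_
    have hx' : information σ s t x ∈ B ∧ σ t (information σ s t x) = v := (hD'iff x).1 hx
    simp only [Set.mem_ofPred_eq, hτdef, if_pos hx', Set.mem_preimage, Set.mem_singleton_iff]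
    exact eq_comm
  have e2 : {x | action σ s t x = θ x} ∩ D' = D' ∩ θ ⁻¹' {v} := by
    ext x
    rw [Set.inter_comm]
    refine and_congr_right fun hx => ?_
    simp only [Set.mem_ofPred_eq, ((hD'iff x).1 hx).2, Set.mem_preimage, Set.mem_singleton_iff]
    exact eq_comm
  have e3 : {x | τ (information σ s t x) = θ x} \ D' = {x | action σ s t x = θ x} \ D' := by
    ext x
    refine and_congr_left fun hx => ?_
    have hx' : ¬ (information σ s t x ∈ B ∧ σ t (information σ s t x) = v) :=
      fun h => hx ((hD'iff x).2 h)
    simp only [Set.mem_ofPred_eq, hτdef, if_neg hx', action]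
  rw [e1, e2, e3, hD', hm.prob_state_inter _ hDm, hm.prob_state_inter _ hDm] at h1
  have h2 : 0 < P.real (ω ⁻¹' {1}) / 2 := half_pos (hm.prob_source_pos hγ 1)
  refine le_of_mul_le_mul_left ?_ h2
  linarith

lemma IsSignalProcess.prob_source_inter_eq_zero (hm : IsSignalProcess P γ μ μ₀ θ ω s)
    {w : Fin 2} {E : Set (ℕ → S)} (hE : MeasurableSet E)
    (h : ∀ v, iidLaw (signalLaw μ μ₀ w v) E = 0) :
    P (ω ⁻¹' {w} ∩ (fun x i => s i x) ⁻¹' E) = 0 := by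
  have hv : ∀ v, P (ω ⁻¹' {w} ∩ θ ⁻¹' {v} ∩ (fun x i => s i x) ⁻¹' E) = 0 := by
    intro v
    rw [← measureReal_eq_zero_iff, hm.prob_type_inter w v hE, (measureReal_def _ E).trans
      (congrArg ENNReal.toReal (h v)), ENNReal.toReal_zero, mul_zero]
  refine measure_mono_null (fun x hx => ?_) (measure_iUnion_null hv)
  exact Set.mem_iUnion.2 ⟨θ x, ⟨hx.1, rfl⟩, hx.2⟩

lemma IsSignalProcess.cond_source_ne_zero (hm : IsSignalProcess P γ μ μ₀ θ ω s)
    (hγ : γ ∈ Set.Ioo (0 : ℝ) 1) {w : Fin 2} {v : State} {E : Set (ℕ → S)} (hE : MeasurableSet E)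
    (hν : IsProbabilityMeasure (signalLaw μ μ₀ w v))
    (h : iidLaw (signalLaw μ μ₀ w v) E ≠ 0) :
    P[|ω ⁻¹' {w}] ((fun x i => s i x) ⁻¹' E) ≠ 0 := by
  refine (cond_pos_of_inter_ne_zero (hm.measurable_source (measurableSet_singleton w))
    fun h0 => ?_).ne'
  have h1 : P.real (ω ⁻¹' {w} ∩ θ ⁻¹' {v} ∩ (fun x i => s i x) ⁻¹' E) = 0 :=
    (measureReal_eq_zero_iff).2 (measure_mono_null
      (Set.inter_subset_inter_left _ Set.inter_subset_left) h0)
  rw [hm.prob_type_inter w v hE] at h1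
  have h2 := hm.prob_source_pos hγ w
  have h3 : 0 < (iidLaw (signalLaw μ μ₀ w v)).real E := ENNReal.toReal_pos h (measure_ne_top _ _)
  exact (mul_pos (half_pos h2) h3).ne' h1

/-- The filtration generated by the histories of actions. -/
def historyFiltration (hσ : ∀ t, Measurable (σ t)) (hs : ∀ t, Measurable (s t)) :
    Filtration ℕ (inferInstance : MeasurableSpace Ω) where
  seq t := MeasurableSpace.comap (history σ s t) inferInstance
  mono' t t' htt' := by
    have h : history σ s t = (fun h (i : Fin t) => h (Fin.castLE htt' i)) ∘ history σ s t' := by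
      funext x i
      simp [history_apply]
    change MeasurableSpace.comap (history σ s t) inferInstance ≤ _
    rw [h, ← MeasurableSpace.comap_comp]
    exact MeasurableSpace.comap_mono (Measurable.comap_le (by fun_prop))
  le' t := (measurable_history hσ hs t).comap_le

lemma measurableSet_eventuallyActs (hσ : ∀ t, Measurable (σ t)) (hs : ∀ t, Measurable (s t))
    (v : State) : MeasurableSet[⨆ t, historyFiltration hσ hs t] (eventuallyActs σ s v) := by
  have ha : ∀ t, MeasurableSet[⨆ t, historyFiltration hσ hs t] {x | action σ s t x = v} := by
    intro t
    -- The action of agent `t` is first recorded in the history of length `t + 1`.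
    refine le_iSup (fun t => historyFiltration hσ hs t) (t + 1) _
      ⟨{h | h (Fin.last t) = v}, (Set.toFinite _).measurableSet, ?_⟩
    ext x
    simp [history_apply]
  have hset : eventuallyActs σ s v = ⋃ T, ⋂ t, ⋂ (_ : T ≤ t), {x | action σ s t x = v} := by
    ext x
    simp [eventuallyActs]
  rw [hset]
  exact MeasurableSet.iUnion fun T => MeasurableSet.iInter fun t => MeasurableSet.iInter fun _ => ha t

theorem IsEquilibrium.asymptoticLearning_of_fatterTails (he : IsEquilibrium P θ s σ)
    (hμ : IsInformationStructure μ μ₀) (hm : IsSignalProcess P γ μ μ₀ θ ω s)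
    (hγ : γ ∈ Set.Ioo (0 : ℝ) 1) (h : FatterTails μ μ₀) : AsymptoticLearning P ω s σ := by
  have ho := he.obedient hm hγ
  have hσ := he.measurable
  have hs := hm.measurable_signal
  set E : Set Ω := ⋃ v, eventuallyActs σ s v with hE
  have hEm : MeasurableSet[⨆ t, historyFiltration hσ hs t] E :=
    MeasurableSet.iUnion fun v => measurableSet_eventuallyActs hσ hs v
  have hcm : ∀ v, MeasurableSet (eventuallyActs σ (coord (S := S)) v) := fun v =>
    iSup_le (fun t => (historyFiltration hσ measurable_coord).le t) _
      (measurableSet_eventuallyActs hσ measurable_coord v)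
  have hpre : E = (fun x i => s i x) ⁻¹' ⋃ v, eventuallyActs σ coord v := by
    simp only [hE, Set.preimage_iUnion, preimage_eventuallyActs]
  have h1 : P (ω ⁻¹' {1} ∩ Eᶜ) = 0 := by
    rw [hpre, ← Set.preimage_compl]
    refine hm.prob_source_inter_eq_zero (MeasurableSet.iUnion hcm).compl fun v => ?_
    simp only [signalLaw, if_true]
    exact measure_mono_null (Set.compl_subset_compl.2 (Set.subset_iUnion _ v))
      (ho.measure_compl_eventuallyActs hμ hσ v)
  have h0 : P (ω ⁻¹' {0} ∩ E) = 0 := by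
    rw [hpre]
    refine hm.prob_source_inter_eq_zero (MeasurableSet.iUnion hcm) fun v => ?_
    simp only [signalLaw, zero_ne_one, if_false]
    exact measure_iUnion_null fun u => ho.measure_eventuallyActs_of_fatterTails hμ hσ h u
  -- Informativeness coincides almost surely with the occurrence of a herd, an event determined by
  -- the actions.
  have hae : (ω ⁻¹' {1}).indicator (fun _ => (1 : ℝ)) =ᵐ[P] E.indicator fun _ => (1 : ℝ) := by
    filter_upwards [measure_eq_zero_iff_ae_notMem.1 h1, measure_eq_zero_iff_ae_notMem.1 h0]
      with x k1 k0
    have k : ω x = 1 ↔ x ∈ E := by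
      constructor
      · intro hx
        by_contra hxE
        exact k1 ⟨hx, hxE⟩
      · intro hxE
        by_contra hx
        exact k0 ⟨by simp only [Set.mem_preimage, Set.mem_singleton_iff]; omega, hxE⟩
    by_cases hx : x ∈ E
    · rw [Set.indicator_of_mem hx, Set.indicator_of_mem (s := ω ⁻¹' {1}) (k.2 hx)]
    · rw [Set.indicator_of_notMem hx,
        Set.indicator_of_notMem (s := ω ⁻¹' {1}) fun hx' => hx (k.1 hx')]
  have hEm' : MeasurableSet E :=
    iSup_le (fun t => (historyFiltration hσ hs).le t) _ hEm
  -- Lévy's upward theorem: `E` is measurable for the limit of the history filtration, so its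
  -- conditional probabilities converge to its indicator.
  have hlevy := Integrable.tendsto_ae_condExp (μ := P) (ℱ := historyFiltration hσ hs)
    ((integrable_const (1 : ℝ)).indicator hEm') (stronglyMeasurable_const.indicator hEm)
  have hbel : ∀ᵐ x ∂P, ∀ t, belief P ω s σ t x
      = (P[E.indicator (fun _ => (1 : ℝ)) | historyFiltration hσ hs t]) x :=
    ae_all_iff.2 fun t => condExp_congr_ae hae
  intro w
  have hw : MeasurableSet (ω ⁻¹' {w}) := hm.measurable_source (measurableSet_singleton w)
  filter_upwards [cond_absolutelyContinuous.ae_le hlevy, cond_absolutelyContinuous.ae_le hbel,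
    cond_absolutelyContinuous.ae_le hae, ae_cond_mem hw] with x k1 k2 k3 k4
  simp only [k2]
  rw [← k3] at k1
  convert k1 using 2
  have k5 : ω x = w := k4
  match w, k5 with
  | 0, k5 => simp [k5]
  | 1, k5 => simp [k5]

theorem IsEquilibrium.not_asymptoticLearning_of_thinnerTails (he : IsEquilibrium P θ s σ)
    (hμ : IsInformationStructure μ μ₀) (hm : IsSignalProcess P γ μ μ₀ θ ω s)
    (hγ : γ ∈ Set.Ioo (0 : ℝ) 1) (h : ThinnerTails μ μ₀) : ¬ AsymptoticLearning P ω s σ := by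
  intro hlearn
  obtain ⟨v, y, h1, h0⟩ :=
    (he.obedient hm hγ).exists_pathEvent_of_thinnerTails hμ he.measurable h
  have hE := measurableSet_pathEvent he.measurable (measurable_coord (S := S)) y
  -- An event of positive probability meets every almost sure event, so learning would supply an
  -- outcome on the path where the belief converges to `w`.
  have hex : ∀ w, iidLaw (signalLaw μ μ₀ w v) (pathEvent σ coord y) ≠ 0 →
      IsProbabilityMeasure (signalLaw μ μ₀ w v) → ∃ x ∈ pathEvent σ s y,
        Tendsto (fun t => belief P ω s σ t x) atTop (𝓝 ((w : ℕ) : ℝ)) := by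
    intro w hw hν
    have h2 := hm.cond_source_ne_zero hγ hE hν hw
    rw [preimage_pathEvent] at h2
    by_contra! hall
    exact h2 (measure_mono_null (fun x hx => hall x hx) (ae_iff.1 (hlearn w)))
  obtain ⟨x₁, hx₁, hl₁⟩ := hex 1 (by simpa [signalLaw] using h1)
    (by simpa [signalLaw] using hμ.isProbabilityMeasure v)
  obtain ⟨x₀, hx₀, hl₀⟩ := hex 0 (by simpa [signalLaw] using h0)
    (by simpa [signalLaw] using hμ.isProbabilityMeasure₀)
  have heq : ∀ t, belief P ω s σ t x₁ = belief P ω s σ t x₀ := fun t =>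
    belief_eq_of_history_eq ((history_eq_of_mem_pathEvent hx₁ t).trans
      (history_eq_of_mem_pathEvent hx₀ t).symm)
  simp only [heq] at hl₁
  simpa using tendsto_nhds_unique hl₁ hl₀

end Equilibrium

end SocialLearning

end

theorem theorem1 {Ω S : Type*} [MeasurableSpace Ω] [MeasurableSpace S]
    (P : Measure Ω) [IsProbabilityMeasure P]
    (γ : ℝ) (hγ : γ ∈ Set.Ioo (0 : ℝ) 1)
    (μ : SocialLearning.State → Measure S) (μ₀ : Measure S)
    (hμ : SocialLearning.IsInformationStructure μ μ₀)
    (θ : Ω → SocialLearning.State) (ω : Ω → Fin 2) (s : ℕ → Ω → S)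
    (hmodel : SocialLearning.IsSignalProcess P γ μ μ₀ θ ω s)
    (σ : ∀ t, SocialLearning.Strategy S t)
    (hσ : SocialLearning.IsEquilibrium P θ s σ) :
    (SocialLearning.FatterTails μ μ₀ → SocialLearning.AsymptoticLearning P ω s σ) ∧
      (SocialLearning.ThinnerTails μ μ₀ → ¬ SocialLearning.AsymptoticLearning P ω s σ) := by
  exact ⟨hσ.asymptoticLearning_of_fatterTails hμ hmodel hγ,
    hσ.not_asymptoticLearning_of_thinnerTails hμ hmodel hγ⟩
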